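/- A *Steiner triple system* STS$(v)$ is a pair $(X,\mathcal B)$, where $X$ is a set of $v$ points and $\mathcal B$ is a set of 3-element subsets of $X$ (called blocks) such that every pair of distinct points lies in exactly one block. An *$\ell$-good sequencing* of $(X,\mathcal B)$ is an ordering $[x_1\,x_2\,\cdots\,x_v]$ of the points, each occurring exactly once, such that no $\ell$ consecutive points in the ordering contain a block. **Theorem.** For every integer $\ell\ge 3$, every STS$(v)$ with $$v\ \ge\ \frac{(\ell-1)(\ell^5-9\ell^3+20\ell^2-36\ell+16)}{16}$$ has an $\ell$-good sequencing. In particular, there is a function $n:\mathbb N\to\mathbb N$ with $n(\ell)=O(\ell^6)$ as $\ell\to\infty$ such that, for every integer $\ell\ge 3$, every STS$(v)$ with $v>n(\ell)$ has an $\ell$-good sequencing. -/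

import Mathlib

universe u

/-- A Steiner triple system of order `v` on the finite point set `X`: a set of 3-element subsets
of `X` (the blocks) such that every pair of distinct points lies in exactly one block. -/
structure SteinerTripleSystem (X : Type u) [Fintype X] (v : ℕ) where
  /-- The set of blocks. -/
  blocks : Finset (Finset X)
  card_points : Fintype.card X = v
  card_block : ∀ B ∈ blocks, B.card = 3
  existsUnique_block : ∀ x y : X, x ≠ y → ∃! B : Finset X, B ∈ blocks ∧ x ∈ B ∧ y ∈ B

namespace SteinerTripleSystem

variable {X : Type u} [Fintype X] {v : ℕ}

/-- The set of points in the positions `i, i + 1, …, i + ℓ - 1` of a permutation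
`[π 0, π 1, …, π (v - 1)]` of the points (positions that are not less than `v` being ignored). -/
def window (π : Fin v ≃ X) (i ℓ : ℕ) : Set X :=
  {x | ∃ j : Fin v, i ≤ (j : ℕ) ∧ (j : ℕ) < i + ℓ ∧ π j = x}

/-- The permutation `[π 0, π 1, …, π (v - 1)]` of the points is an `ℓ`-good sequencing:
no `ℓ` consecutive points contain a block. -/
def IsGoodSequencing (S : SteinerTripleSystem X v) (ℓ : ℕ) (π : Fin v ≃ X) : Prop :=
  ∀ i : ℕ, ∀ B ∈ S.blocks, ¬ ((B : Set X) ⊆ window π i ℓ)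

/-- The Steiner triple system has an `ℓ`-good sequencing. -/
def HasGoodSequencing (S : SteinerTripleSystem X v) (ℓ : ℕ) : Prop :=
  ∃ π : Fin v ≃ X, S.IsGoodSequencing ℓ π

end SteinerTripleSystem

/-! A greedy left-to-right filling needs a point avoiding those already used and the third points of
pairs among the preceding `ℓ - 1` positions. There are at most `m = (ℓ-1)(ℓ-2)/2` such pairs, so the
greedy choice is safe while more than `m` points are unused; only the end is a problem.

The remedy is to reserve `m` positions: the holes, spaced `ℓ` apart in the first `m` segments. The
rest of these segments is filled greedily, and `Z` collects the third points of their close pairs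
(`exists_finset_third`). The unused points of `Z` go to markers, one per later segment
(`GoodOn.place`), and the remaining non-hole positions are filled greedily (`GoodOn.fill_step`). The
`m` leftover points may then enter the holes in any order: a bad triple around a hole would need a
point of `Z`, and all of those are used (`GoodOn.fill_holes`). -/

/-! ### Arithmetic of holes, solid positions and markers -/

open Finset in
/-- The positions `0, ℓ, …, (m - 1) * ℓ`, which are left empty until the end. -/
def holes (m ℓ : ℕ) : Finset ℕ := (range m).image (· * ℓ)

open Finset in
/-- The positions below `n` that are not holes. -/
def solid (m ℓ n : ℕ) : Finset ℕ := range n \ holes m ℓ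

open Finset in
/-- The last positions of the `k` segments of length `ℓ` that follow the segments with holes. -/
def markers (m ℓ k : ℕ) : Finset ℕ := (range k).image fun i => (m + i) * ℓ + (ℓ - 1)

lemma mem_holes {m ℓ q : ℕ} : q ∈ holes m ℓ ↔ ∃ i < m, i * ℓ = q := by
  simp [holes]

lemma mem_solid {m ℓ n q : ℕ} : q ∈ solid m ℓ n ↔ q < n ∧ q ∉ holes m ℓ := by
  simp [solid]

lemma mem_markers {m ℓ k q : ℕ} :
    q ∈ markers m ℓ k ↔ ∃ i < k, (m + i) * ℓ + (ℓ - 1) = q := by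
  simp [markers]

lemma solid_mono {m ℓ n n' : ℕ} (h : n ≤ n') : solid m ℓ n ⊆ solid m ℓ n' := fun q hq => by
  rw [mem_solid] at hq ⊢
  exact ⟨hq.1.trans_le h, hq.2⟩

lemma le_of_mul_lt_mul_add {ℓ i j : ℕ} (h : i * ℓ < j * ℓ + ℓ) : i ≤ j := by
  rw [← Nat.succ_mul] at h
  exact Nat.lt_succ_iff.1 (lt_of_mul_lt_mul_right h (Nat.zero_le ℓ))

lemma lt_of_mem_holes {m ℓ q : ℕ} (hℓ : 0 < ℓ) (h : q ∈ holes m ℓ) : q < m * ℓ := by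
  obtain ⟨i, hi, rfl⟩ := mem_holes.1 h
  exact Nat.mul_lt_mul_of_pos_right hi hℓ

lemma le_of_mem_markers {m ℓ k q : ℕ} (h : q ∈ markers m ℓ k) : m * ℓ + (ℓ - 1) ≤ q := by
  obtain ⟨i, -, rfl⟩ := mem_markers.1 h
  gcongr
  omega

lemma lt_of_mem_markers {m ℓ k q : ℕ} (hℓ : 0 < ℓ) (h : q ∈ markers m ℓ k) :
    q < (m + k) * ℓ := by
  obtain ⟨i, hi, rfl⟩ := mem_markers.1 h
  have : (m + i + 1) * ℓ ≤ (m + k) * ℓ := Nat.mul_le_mul_right _ (by omega)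
  rw [Nat.succ_mul] at this
  omega

lemma markers_subset_solid {m ℓ k n : ℕ} (hℓ : 0 < ℓ) (hn : (m + k) * ℓ ≤ n) :
    markers m ℓ k ⊆ solid m ℓ n := fun q hq => by
  refine mem_solid.2 ⟨(lt_of_mem_markers hℓ hq).trans_le hn, fun h => ?_⟩
  have := lt_of_mem_holes hℓ h
  have := le_of_mem_markers hq
  omega

lemma eq_of_mem_markers {m ℓ k q r : ℕ} (hq : q ∈ markers m ℓ k) (hr : r ∈ markers m ℓ k)
    (h₁ : q < r + ℓ) (h₂ : r < q + ℓ) : q = r := by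
  obtain ⟨i, -, rfl⟩ := mem_markers.1 hq
  obtain ⟨j, -, rfl⟩ := mem_markers.1 hr
  have h₃ : m + i ≤ m + j := le_of_mul_lt_mul_add (ℓ := ℓ) (by omega)
  have h₄ : m + j ≤ m + i := le_of_mul_lt_mul_add (ℓ := ℓ) (by omega)
  rw [le_antisymm h₃ h₄]

lemma card_solid {m ℓ n : ℕ} (hℓ : 0 < ℓ) (hn : m * ℓ ≤ n) : (solid m ℓ n).card + m = n := by
  have hsub : holes m ℓ ⊆ Finset.range n := fun q hq =>
    Finset.mem_range.2 ((lt_of_mem_holes hℓ hq).trans_le hn)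
  have hcard : (holes m ℓ).card = m := by
    rw [holes, Finset.card_image_of_injective _ (fun a b h => Nat.eq_of_mul_eq_mul_right hℓ h),
      Finset.card_range]
  have := Finset.card_sdiff_add_card_eq_card hsub
  rwa [hcard, Finset.card_range] at this

lemma solid_succ_of_mem {m ℓ p : ℕ} (hp : p ∈ holes m ℓ) :
    solid m ℓ (p + 1) = solid m ℓ p := by
  ext q
  simp only [mem_solid, Nat.lt_succ_iff_lt_or_eq]
  constructor
  · rintro ⟨h | rfl, h'⟩
    · exact ⟨h, h'⟩
    · exact absurd hp h'
  · exact fun h => ⟨Or.inl h.1, h.2⟩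

lemma solid_succ_of_notMem {m ℓ p : ℕ} (hp : p ∉ holes m ℓ) :
    solid m ℓ (p + 1) = insert p (solid m ℓ p) := by
  ext q
  simp only [mem_solid, Nat.lt_succ_iff_lt_or_eq, Finset.mem_insert]
  constructor
  · rintro ⟨h | rfl, h'⟩
    · exact Or.inr ⟨h, h'⟩
    · exact Or.inl rfl
  · rintro (rfl | h)
    · exact ⟨Or.inr rfl, hp⟩
    · exact ⟨Or.inl h.1, h.2⟩

/-! ### Blocks as collinear triples -/

namespace SteinerTripleSystem

variable {X : Type u} [Fintype X] {v : ℕ} (S : SteinerTripleSystem X v)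

/-- Three distinct points that form a block. -/
def Collinear (a b c : X) : Prop :=
  a ≠ b ∧ a ≠ c ∧ b ≠ c ∧ ∃ B ∈ S.blocks, a ∈ B ∧ b ∈ B ∧ c ∈ B

open Classical in
/-- The third point of the block through two distinct points. -/
noncomputable def third (a b : X) : X :=
  -- The default value is harmless: it can only enlarge the sets of points to avoid.
  if h : ∃ c, S.Collinear a b c then h.choose else a

variable {S}

lemma Collinear.swap {a b c : X} (h : S.Collinear a b c) : S.Collinear b a c := by
  obtain ⟨h₁, h₂, h₃, B, hB, ha, hb, hc⟩ := h
  exact ⟨h₁.symm, h₃, h₂, B, hB, hb, ha, hc⟩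

lemma Collinear.rotate {a b c : X} (h : S.Collinear a b c) : S.Collinear b c a := by
  obtain ⟨h₁, h₂, h₃, B, hB, ha, hb, hc⟩ := h
  exact ⟨h₃, h₁.symm, h₂.symm, B, hB, hb, hc, ha⟩

lemma Collinear.eq_of_collinear {a b c d : X} (h : S.Collinear a b c) (h' : S.Collinear a b d) :
    c = d := by
  classical
  obtain ⟨hab, hac, hbc, B, hB, ha, hb, hc⟩ := h
  obtain ⟨-, had, hbd, B', hB', ha', hb', hd⟩ := h'
  obtain rfl : B = B' := (S.existsUnique_block a b hab).unique ⟨hB, ha, hb⟩ ⟨hB', ha', hb'⟩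
  by_contra hcd
  have hsub : ({a, b, c, d} : Finset X) ⊆ B := by
    simp [Finset.insert_subset_iff, ha, hb, hc, hd]
  have hcard : ({a, b, c, d} : Finset X).card = 4 := by
    rw [Finset.card_insert_of_notMem (by simp [hab, hac, had]),
      Finset.card_insert_of_notMem (by simp [hbc, hbd]), Finset.card_pair hcd]
  have := Finset.card_le_card hsub
  rw [hcard, S.card_block B hB] at this
  omega

lemma Collinear.third_eq {a b c : X} (h : S.Collinear a b c) : S.third a b = c := by
  have hex : ∃ c, S.Collinear a b c := ⟨c, h⟩
  rw [third, dif_pos hex]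
  exact hex.choose_spec.eq_of_collinear h

/-! ### Partial sequencings and greedy extension -/

variable (S) in
/-- A partial `ℓ`-good sequencing: `f` assigns distinct points to the positions in `A` so that no
block occupies three positions of `A` among `ℓ` consecutive positions. -/
def GoodOn (ℓ : ℕ) (f : ℕ → X) (A : Finset ℕ) : Prop :=
  Set.InjOn f A ∧ ∀ i ∈ A, ∀ j ∈ A, ∀ k ∈ A, i < j → j < k → k < i + ℓ →
    ¬ S.Collinear (f i) (f j) (f k)

/-- The inequalities in `hpair` say that `p`, `q`, `r` share a window of length `ℓ`, wherever `p`
lies relative to `q < r`. -/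
lemma GoodOn.extend {ℓ : ℕ} {f : ℕ → X} {A : Finset ℕ} (h : S.GoodOn ℓ f A) {p : ℕ} (hp : p ∉ A)
    {x : X} (hx : ∀ q ∈ A, f q ≠ x)
    (hpair : ∀ q ∈ A, ∀ r ∈ A, q < r → r < q + ℓ → p < q + ℓ → r < p + ℓ →
      ¬ S.Collinear (f q) (f r) x) :
    ∃ f' : ℕ → X, f' p = x ∧ (∀ q ∈ A, f' q = f q) ∧ S.GoodOn ℓ f' (insert p A) := by
  have hne : ∀ q ∈ A, q ≠ p := fun q hq e => hp (e ▸ hq)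
  have hf : ∀ q ∈ A, Function.update f p x q = f q := fun q hq =>
    Function.update_of_ne (hne q hq) _ _
  have hfp : Function.update f p x p = x := Function.update_self _ _ _
  refine ⟨Function.update f p x, hfp, hf, ?_, ?_⟩
  · rw [Finset.coe_insert, Set.injOn_insert (by simpa using hp)]
    refine ⟨fun a ha b hb hab => ?_, ?_⟩
    · rw [hf a ha, hf b hb] at hab
      exact h.1 ha hb hab
    · rintro ⟨q, hq, hqp⟩
      rw [hf q hq, hfp] at hqp
      exact hx q hq hqp
  · intro i hi j hj k hk hij hjk hki hcol
    rw [Finset.mem_insert] at hi hj hk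
    rcases hi with rfl | hi
    · replace hj := hj.resolve_left hij.ne'
      replace hk := hk.resolve_left (hij.trans hjk).ne'
      rw [hf j hj, hf k hk, hfp] at hcol
      exact hpair j hj k hk hjk (by omega) (by omega) (by omega) hcol.rotate
    rcases hj with rfl | hj
    · replace hk := hk.resolve_left hjk.ne'
      rw [hf i hi, hf k hk, hfp] at hcol
      exact hpair i hi k hk (by omega) (by omega) (by omega) (by omega) hcol.swap.rotate
    rcases hk with rfl | hk
    · rw [hf i hi, hf j hj, hfp] at hcol
      exact hpair i hi j hj hij (by omega) (by omega) (by omega) hcol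
    · rw [hf i hi, hf j hj, hf k hk] at hcol
      exact h.2 i hi j hj k hk hij hjk hki hcol

lemma GoodOn.exists_extend {ℓ : ℕ} {f : ℕ → X} {A : Finset ℕ} (h : S.GoodOn ℓ f A) {p : ℕ}
    (hp : p ∉ A) (F : Finset X) (hF : A.card + F.card < v)
    (hpair : ∀ q ∈ A, ∀ r ∈ A, q < r → r < q + ℓ → p < q + ℓ → r < p + ℓ →
      ∀ x, S.Collinear (f q) (f r) x → (∃ s ∈ A, f s = x) ∨ x ∈ F) :
    ∃ f' : ℕ → X, (∀ q ∈ A, f' q = f q) ∧ S.GoodOn ℓ f' (insert p A) := by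
  classical
  obtain ⟨x, hx⟩ : ∃ x, x ∉ A.image f ∪ F := by
    by_contra! hall
    have h₁ : (A.image f ∪ F).card = v := by
      rw [Finset.eq_univ_iff_forall.2 hall, Finset.card_univ, S.card_points]
    have h₂ := Finset.card_union_le (A.image f) F
    have h₃ : (A.image f).card ≤ A.card := Finset.card_image_le
    omega
  rw [Finset.mem_union, not_or] at hx
  obtain ⟨f', -, h₁, h₂⟩ := h.extend hp (x := x)
    (fun q hq e => hx.1 (e ▸ Finset.mem_image_of_mem f hq))
    (fun q hq r hr h₁ h₂ h₃ h₄ hcol => by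
      rcases hpair q hq r hr h₁ h₂ h₃ h₄ x hcol with h | h
      exacts [hx.1 (Finset.mem_image.2 h), hx.2 h])
  exact ⟨f', h₁, h₂⟩

/-- One greedy step at a position `p` with everything before it (except holes) filled. -/
lemma GoodOn.fill_step {m ℓ k p : ℕ} (hℓ : 3 ≤ ℓ) (hm : 2 * m = (ℓ - 1) * (ℓ - 2))
    (hv : (m + k) * ℓ + ℓ ≤ v + 2) (hpv : p < v) {f : ℕ → X}
    (h : S.GoodOn ℓ f (solid m ℓ p ∪ markers m ℓ k)) :
    ∃ f' : ℕ → X, (∀ q ∈ solid m ℓ p ∪ markers m ℓ k, f' q = f q) ∧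
      S.GoodOn ℓ f' (solid m ℓ (p + 1) ∪ markers m ℓ k) := by
  classical
  have hℓ0 : 0 < ℓ := by omega
  by_cases hph : p ∈ holes m ℓ
  · rw [solid_succ_of_mem hph]
    exact ⟨f, fun _ _ => rfl, h⟩
  rw [solid_succ_of_notMem hph, Finset.insert_union]
  by_cases hpm : p ∈ markers m ℓ k
  · rw [Finset.insert_eq_of_mem (Finset.mem_union_right _ hpm)]
    exact ⟨f, fun _ _ => rfl, h⟩
  have hpA : p ∉ solid m ℓ p ∪ markers m ℓ k := by
    simp [mem_solid, hpm]
  -- The filled positions miss `p` and all `m` holes below `n`.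
  have hcard : ∀ n, p < n → (m + k) * ℓ ≤ n →
      (solid m ℓ p ∪ markers m ℓ k).card + m < n := by
    intro n hpn hn
    have hpn' : p ∈ solid m ℓ n := mem_solid.2 ⟨hpn, hph⟩
    have hsub : solid m ℓ p ∪ markers m ℓ k ⊆ (solid m ℓ n).erase p := by
      intro q hq
      refine Finset.mem_erase.2 ⟨fun e => hpA (e ▸ hq), ?_⟩
      exact Finset.union_subset (solid_mono hpn.le) (markers_subset_solid hℓ0 hn) hq
    have h₁ := Finset.card_le_card hsub
    have h₂ := Finset.card_erase_add_one hpn'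
    have h₃ := card_solid hℓ0 ((Nat.mul_le_mul_right ℓ (Nat.le_add_right m k)).trans hn)
    omega
  -- third points of pairs of positions before `p`
  let F₁ : Finset X := ((Finset.range (ℓ - 1)).sigma fun d => Finset.range d).image
    fun y => S.third (f (p - 1 - y.1)) (f (p - 1 - y.2))
  have hF₁ : F₁.card ≤ m := by
    refine Finset.card_image_le.trans ?_
    rw [Finset.card_sigma]
    simp only [Finset.card_range]
    have h₁ := Finset.sum_range_id_mul_two (ℓ - 1)
    have h₂ : ℓ - 1 - 1 = ℓ - 2 := by omega
    rw [h₂] at h₁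
    omega
  have hmem₁ : ∀ q r x, q < r → r < p → p < q + ℓ → S.Collinear (f q) (f r) x → x ∈ F₁ := by
    intro q r x hqr hrp hpq hcol
    refine Finset.mem_image.2 ⟨⟨p - 1 - q, p - 1 - r⟩, ?_, ?_⟩
    · simp only [Finset.mem_sigma, Finset.mem_range]
      omega
    · have h₁ : p - 1 - (p - 1 - q) = q := by omega
      have h₂ : p - 1 - (p - 1 - r) = r := by omega
      simp only [h₁, h₂]
      exact hcol.third_eq
  by_cases hw : ∃ w ∈ markers m ℓ k, p < w ∧ w < p + ℓ
  · obtain ⟨w, hwm, hpw, hwp⟩ := hw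
    -- A window containing `p` and `w > p` reaches at most `ℓ - 2` positions before `p`.
    let F₂ : Finset X := (Finset.range (ℓ - 2)).image fun d => S.third (f (p - 1 - d)) (f w)
    have hF₂ : F₂.card ≤ ℓ - 2 := Finset.card_image_le.trans (Finset.card_range _).le
    refine h.exists_extend hpA (F₁ ∪ F₂) ?_ ?_
    -- The extra `ℓ - 2` forbidden points are paid for by the positions beyond the marker segments,
    -- by `hv`.
    · have h₁ := hcard _ (hpw.trans (lt_of_mem_markers hℓ0 hwm)) le_rfl
      have h₂ := Finset.card_union_le F₁ F₂
      omega
    · intro q hq r hr hqr hrq hpq hrp x hcol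
      right
      have hqp : q < p := by
        by_contra hqp
        have hq' : q ∈ markers m ℓ k := (Finset.mem_union.1 hq).resolve_left fun h =>
          hqp (mem_solid.1 h).1
        have hr' : r ∈ markers m ℓ k := (Finset.mem_union.1 hr).resolve_left fun h => by
          have := (mem_solid.1 h).1
          omega
        have := eq_of_mem_markers hq' hr' (by omega) hrq
        omega
      rw [Finset.mem_union]
      by_cases hr' : r ∈ solid m ℓ p
      · exact Or.inl (hmem₁ q r x hqr (mem_solid.1 hr').1 hpq hcol)
      by_cases hrp' : r < p
      · exact Or.inl (hmem₁ q r x hqr hrp' hpq hcol)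
      · replace hr' := (Finset.mem_union.1 hr).resolve_left hr'
        have hne : r ≠ p := fun e => hpm (e ▸ hr')
        obtain rfl : r = w := eq_of_mem_markers hr' hwm (by omega) (by omega)
        refine Or.inr (Finset.mem_image.2 ⟨p - 1 - q, ?_, ?_⟩)
        · rw [Finset.mem_range]
          omega
        · have h₁ : p - 1 - (p - 1 - q) = q := by omega
          simp only [h₁]
          exact hcol.third_eq
  · push Not at hw
    refine h.exists_extend hpA F₁ ?_ ?_
    · have := hcard v hpv (by omega)
      omega
    · intro q hq r hr hqr hrq hpq hrp x hcol
      have hrp' : r < p := by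
        rcases Finset.mem_union.1 hr with h | h
        · exact (mem_solid.1 h).1
        · by_contra hrp'
          have hne : r ≠ p := fun e => hpm (e ▸ h)
          have := hw r h (by omega)
          omega
      exact Or.inr (hmem₁ q r x hqr hrp' hpq hcol)

lemma GoodOn.fill {m ℓ k a b : ℕ} (hℓ : 3 ≤ ℓ) (hm : 2 * m = (ℓ - 1) * (ℓ - 2))
    (hv : (m + k) * ℓ + ℓ ≤ v + 2) (hab : a ≤ b) (hbv : b ≤ v) {f : ℕ → X}
    (h : S.GoodOn ℓ f (solid m ℓ a ∪ markers m ℓ k)) :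
    ∃ f' : ℕ → X, (∀ q ∈ solid m ℓ a ∪ markers m ℓ k, f' q = f q) ∧
      S.GoodOn ℓ f' (solid m ℓ b ∪ markers m ℓ k) := by
  induction b, hab using Nat.le_induction with
  | base => exact ⟨f, fun _ _ => rfl, h⟩
  | succ b hab ih =>
    obtain ⟨g, hg, hgood⟩ := ih (by omega)
    obtain ⟨g', hg', hgood'⟩ := hgood.fill_step hℓ hm hv (by omega)
    refine ⟨g', fun q hq => ?_, hgood'⟩
    rw [hg' q (Finset.union_subset_union_left (solid_mono hab) hq), hg q hq]

/-! ### Placing the third points and filling the holes -/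

lemma markers_succ (m ℓ k : ℕ) :
    markers m ℓ (k + 1) = insert ((m + k) * ℓ + (ℓ - 1)) (markers m ℓ k) := by
  rw [markers, Finset.range_add_one, Finset.image_insert, markers]

open Classical in
/-- Prescribed unused points can be put at the marker positions. -/
lemma GoodOn.place {m ℓ : ℕ} (hℓ : 0 < ℓ) {f : ℕ → X} (h : S.GoodOn ℓ f (solid m ℓ (m * ℓ)))
    (Z : Finset X) (hZ : Disjoint Z ((solid m ℓ (m * ℓ)).image f)) :
    ∃ f' : ℕ → X, (∀ q ∈ solid m ℓ (m * ℓ), f' q = f q) ∧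
      S.GoodOn ℓ f' (solid m ℓ (m * ℓ) ∪ markers m ℓ Z.card) ∧
      (solid m ℓ (m * ℓ) ∪ markers m ℓ Z.card).image f' = (solid m ℓ (m * ℓ)).image f ∪ Z := by
  induction Z using Finset.induction_on with
  | empty => exact ⟨f, fun _ _ => rfl, by simpa [markers] using h, by simp [markers]⟩
  | insert z Z hz ih =>
    rw [Finset.disjoint_insert_left] at hZ
    obtain ⟨g, hg, hgood, himg⟩ := ih hZ.2
    -- Being last in its segment, the new marker shares no window with a filled position, so any
    -- unused point fits.
    have hfar : ∀ q ∈ solid m ℓ (m * ℓ) ∪ markers m ℓ Z.card,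
        q + ℓ ≤ (m + Z.card) * ℓ + (ℓ - 1) := by
      intro q hq
      rcases Finset.mem_union.1 hq with h | h
      · have h₁ := (mem_solid.1 h).1
        have h₂ : m * ℓ ≤ (m + Z.card) * ℓ := Nat.mul_le_mul_right _ (by omega)
        omega
      · have := lt_of_mem_markers hℓ h
        omega
    obtain ⟨g', hgz, hg', hgood'⟩ := hgood.extend (p := (m + Z.card) * ℓ + (ℓ - 1)) (x := z)
      (fun hp => by have := hfar _ hp; omega)
      (fun q hq e => by
        have : z ∈ (solid m ℓ (m * ℓ) ∪ markers m ℓ Z.card).image g :=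
          e ▸ Finset.mem_image_of_mem g hq
        rw [himg, Finset.mem_union] at this
        exact this.elim hZ.1 hz)
      (fun q hq r hr _ _ h₁ _ => by have := hfar q hq; omega)
    rw [Finset.card_insert_of_notMem hz, markers_succ, Finset.union_insert]
    refine ⟨g', fun q hq => ?_, hgood', ?_⟩
    · rw [hg' q (Finset.mem_union_left _ hq), hg q hq]
    · rw [Finset.image_insert, hgz, Finset.image_congr (g := g) (fun q hq => hg' q hq), himg,
        Finset.union_insert]

lemma GoodOn.fill_holes {m ℓ : ℕ} (hℓ : 0 < ℓ) (hv : m * ℓ ≤ v) {f : ℕ → X}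
    (h : S.GoodOn ℓ f (solid m ℓ v))
    (hthird : ∀ q ∈ solid m ℓ (m * ℓ), ∀ r ∈ solid m ℓ (m * ℓ), q < r → r < q + ℓ →
      ∀ x, S.Collinear (f q) (f r) x → ∃ s ∈ solid m ℓ v, f s = x)
    (j : ℕ) (hj : j ≤ m) :
    ∃ f' : ℕ → X, (∀ q ∈ solid m ℓ v, f' q = f q) ∧
      S.GoodOn ℓ f' (solid m ℓ v ∪ holes j ℓ) := by
  classical
  induction j with
  | zero => exact ⟨f, fun _ _ => rfl, by simpa [holes] using h⟩
  | succ j ih =>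
    obtain ⟨g, hg, hgood⟩ := ih (by omega)
    have hsucc : holes (j + 1) ℓ = insert (j * ℓ) (holes j ℓ) := by
      rw [holes, Finset.range_add_one, Finset.image_insert, holes]
    have hjm : j * ℓ + ℓ ≤ m * ℓ := by
      rw [← Nat.succ_mul]
      exact Nat.mul_le_mul_right _ hj
    have hp : j * ℓ ∉ solid m ℓ v ∪ holes j ℓ := by
      rw [Finset.mem_union, not_or]
      refine ⟨fun h => (mem_solid.1 h).2 (mem_holes.2 ⟨j, by omega, rfl⟩), fun h => ?_⟩
      exact (lt_of_mem_holes hℓ h).false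
    -- No other hole is within distance less than `ℓ`, so only pairs covered by `hthird` matter.
    have hnear : ∀ q ∈ solid m ℓ v ∪ holes j ℓ, q < j * ℓ + ℓ → j * ℓ < q + ℓ →
        q ∈ solid m ℓ (m * ℓ) := by
      intro q hq h₁ h₂
      refine mem_solid.2 ⟨by omega, fun hqh => ?_⟩
      obtain ⟨i, -, rfl⟩ := mem_holes.1 hqh
      rw [le_antisymm (le_of_mul_lt_mul_add h₁) (le_of_mul_lt_mul_add h₂)] at hq
      exact hp hq
    have hcard : (solid m ℓ v ∪ holes j ℓ).card < v := by
      have hsub : solid m ℓ v ∪ holes j ℓ ⊂ Finset.range v := by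
        refine (Finset.ssubset_iff_of_subset ?_).2 ⟨j * ℓ, Finset.mem_range.2 (by omega), hp⟩
        refine Finset.union_subset Finset.sdiff_subset fun q hq => Finset.mem_range.2 ?_
        have := lt_of_mem_holes hℓ hq
        omega
      simpa using Finset.card_lt_card hsub
    obtain ⟨g', hg', hgood'⟩ := hgood.exists_extend hp ∅ (by simpa using hcard)
      (fun q hq r hr h₁ h₂ h₃ h₄ x hcol => by
        have hq' := hnear q hq (by omega) h₃
        have hr' := hnear r hr h₄ (by omega)
        rw [hg q (solid_mono hv hq'), hg r (solid_mono hv hr')] at hcol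
        obtain ⟨s, hs, hsx⟩ := hthird q hq' r hr' h₁ h₂ x hcol
        exact Or.inl ⟨s, Finset.mem_union_left _ hs, by rw [hg s hs, hsx]⟩)
    refine ⟨g', fun q hq => ?_, ?_⟩
    · rw [hg' q (Finset.mem_union_left _ hq), hg q hq]
    · rwa [hsucc, Finset.union_insert]

/-! ### Assembly and numerical bounds -/

lemma GoodOn.hasGoodSequencing {ℓ : ℕ} {f : ℕ → X} (h : S.GoodOn ℓ f (Finset.range v)) :
    S.HasGoodSequencing ℓ := by
  classical
  have hinj : Function.Injective fun i : Fin v => f i := fun i j hij =>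
    Fin.ext (h.1 (by simp) (by simp) hij)
  have hbij : Function.Bijective fun i : Fin v => f i :=
    (Fintype.bijective_iff_injective_and_card _).2 ⟨hinj, by simp [S.card_points]⟩
  refine ⟨Equiv.ofBijective _ hbij, fun i B hB hsub => ?_⟩
  obtain ⟨a, b, c, hab, hac, hbc, hBe⟩ := Finset.card_eq_three.1 (S.card_block B hB)
  obtain ⟨p, hp₁, hp₂, rfl⟩ := hsub (show a ∈ B by simp [hBe])
  obtain ⟨q, hq₁, hq₂, rfl⟩ := hsub (show b ∈ B by simp [hBe])
  obtain ⟨r, hr₁, hr₂, rfl⟩ := hsub (show c ∈ B by simp [hBe])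
  have hcol : S.Collinear (f p) (f q) (f r) :=
    ⟨hab, hac, hbc, B, hB, by simp [hBe], by simp [hBe], by simp [hBe]⟩
  have key : ∀ p q r : Fin v, i ≤ (p : ℕ) → (r : ℕ) < i + ℓ → (p : ℕ) < q → (q : ℕ) < r →
      ¬ S.Collinear (f p) (f q) (f r) := fun p q r h₁ h₂ h₃ h₄ =>
    h.2 p (by simp) q (by simp) r (by simp) h₃ h₄ (by omega)
  have hpq : (p : ℕ) ≠ q := fun e => hab (by rw [Fin.ext e])
  have hpr : (p : ℕ) ≠ r := fun e => hac (by rw [Fin.ext e])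
  have hqr : (q : ℕ) ≠ r := fun e => hbc (by rw [Fin.ext e])
  rcases hpq.lt_or_gt with h₁ | h₁ <;> rcases hpr.lt_or_gt with h₂ | h₂ <;>
    rcases hqr.lt_or_gt with h₃ | h₃
  · exact key p q r hp₁ hr₂ h₁ h₃ hcol
  · exact key p r q hp₁ hq₂ h₂ h₃ hcol.rotate.rotate.swap
  · omega
  · exact key r p q hr₁ hq₂ h₂ h₁ hcol.rotate.rotate
  · exact key q p r hq₁ hr₂ h₁ h₂ hcol.swap
  · omega
  · exact key q r p hq₁ hp₂ h₃ h₂ hcol.rotate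
  · exact key r q p hr₁ hp₂ h₃ h₁ hcol.rotate.swap

/-- The third points of the pairs of points at positions close to each other in the initial
segments with holes. -/
lemma exists_finset_third (S : SteinerTripleSystem X v) {m ℓ : ℕ} (hℓ : 3 ≤ ℓ) (f : ℕ → X) :
    ∃ Z : Finset X, Z.card ≤ m * (ℓ - 1) * (ℓ - 2) ∧
      ∀ q ∈ solid m ℓ (m * ℓ), ∀ r ∈ solid m ℓ (m * ℓ), q < r → r < q + ℓ →
        ∀ x, S.Collinear (f q) (f r) x → x ∈ Z := by
  classical
  have hℓ0 : 0 < ℓ := by omega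
  -- Going back `r % ℓ` from `r` lands on a hole, so `ℓ - 2` distances remain for each of the `m *
  -- (ℓ - 1)` choices of `r`.
  refine ⟨((solid m ℓ (m * ℓ)).sigma fun r => (Finset.Ioo 0 ℓ).erase (r % ℓ)).image
    fun y => S.third (f (y.1 - y.2)) (f y.1), ?_, ?_⟩
  · refine Finset.card_image_le.trans ?_
    have hmod : ∀ r ∈ solid m ℓ (m * ℓ), 0 < r % ℓ := fun r hr => by
      by_contra h0
      obtain ⟨c, rfl⟩ : ℓ ∣ r := Nat.dvd_of_mod_eq_zero (by omega)
      have hr' := mem_solid.1 hr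
      rw [mul_comm ℓ c] at hr'
      exact hr'.2 (mem_holes.2 ⟨c, lt_of_mul_lt_mul_right hr'.1 (Nat.zero_le ℓ), rfl⟩)
    rw [Finset.card_sigma, Finset.sum_congr rfl (g := fun _ => ℓ - 2), Finset.sum_const,
      smul_eq_mul]
    · have h₁ := card_solid (m := m) hℓ0 le_rfl
      have h₂ : m * (ℓ - 1) + m = m * ℓ := by
        rw [← Nat.mul_succ]
        congr 1
        omega
      rw [show (solid m ℓ (m * ℓ)).card = m * (ℓ - 1) by omega]
    · intro r hr
      rw [Finset.card_erase_of_mem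
        (Finset.mem_Ioo.2 ⟨hmod r hr, Nat.mod_lt _ hℓ0⟩), Nat.card_Ioo]
      omega
  · intro q hq r hr hqr hrq x hcol
    refine Finset.mem_image.2 ⟨⟨r, r - q⟩, ?_, ?_⟩
    · simp only [Finset.mem_sigma, Finset.mem_erase, Finset.mem_Ioo]
      refine ⟨hr, fun e => ?_, by omega, by omega⟩
      have hq' := mem_solid.1 hq
      have hdiv := Nat.div_add_mod r ℓ
      have hqe : r / ℓ * ℓ = q := by
        rw [mul_comm]
        omega
      refine hq'.2 (mem_holes.2 ⟨r / ℓ, ?_, hqe⟩)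
      exact lt_of_mul_lt_mul_right (hqe ▸ hq'.1) (Nat.zero_le ℓ)
    · have h₁ : r - (r - q) = q := by omega
      simp only [h₁]
      exact hcol.third_eq

theorem hasGoodSequencing_of_le (S : SteinerTripleSystem X v) {m ℓ : ℕ} (hℓ : 3 ≤ ℓ)
    (hm : 2 * m = (ℓ - 1) * (ℓ - 2))
    (hv : (m + m * (ℓ - 1) * (ℓ - 2)) * ℓ + ℓ ≤ v + 2) : S.HasGoodSequencing ℓ := by
  classical
  have hℓ0 : 0 < ℓ := by omega
  have hbound : ∀ k ≤ m * (ℓ - 1) * (ℓ - 2), (m + k) * ℓ + ℓ ≤ v + 2 := fun k hk =>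
    (Nat.add_le_add_right (Nat.mul_le_mul_right ℓ (Nat.add_le_add_left hk m)) ℓ).trans hv
  have hmv : m * ℓ ≤ v := by
    have := hbound 0 (Nat.zero_le _)
    rw [add_zero] at this
    omega
  have hX : Nonempty X := by
    have := hbound 0 (Nat.zero_le _)
    exact Fintype.card_pos_iff.1 (by rw [S.card_points]; omega)
  have h₀ : S.GoodOn ℓ (fun _ => hX.some) (solid m ℓ 0 ∪ markers m ℓ 0) := by
    simp [GoodOn, solid, markers]
  obtain ⟨f, -, hf⟩ := h₀.fill hℓ hm (hbound 0 (Nat.zero_le _)) (Nat.zero_le (m * ℓ)) hmv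
  rw [show markers m ℓ 0 = ∅ by simp [markers], Finset.union_empty] at hf
  obtain ⟨Z, hZcard, hZ⟩ := S.exists_finset_third (m := m) hℓ f
  obtain ⟨g, hgf, hg, himg⟩ :=
    hf.place hℓ0 (Z \ (solid m ℓ (m * ℓ)).image f) Finset.sdiff_disjoint
  have hk := hbound _ ((Finset.card_le_card
    (Finset.sdiff_subset (s := Z) (t := (solid m ℓ (m * ℓ)).image f))).trans hZcard)
  obtain ⟨w, hwg, hw⟩ := hg.fill hℓ hm hk hmv le_rfl
  have hsub := markers_subset_solid (n := v) hℓ0 (Nat.le_of_add_le_add_right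
    ((Nat.add_le_add_left (show 2 ≤ ℓ by omega) _).trans hk))
  rw [Finset.union_eq_left.2 hsub] at hw
  obtain ⟨u, -, hu⟩ := hw.fill_holes hℓ0 hmv (fun q hq r hr h₁ h₂ x hcol => by
    rw [hwg q (Finset.mem_union_left _ hq), hwg r (Finset.mem_union_left _ hr), hgf q hq,
      hgf r hr] at hcol
    have hx : x ∈ (solid m ℓ (m * ℓ)).image f ∪ (Z \ (solid m ℓ (m * ℓ)).image f) := by
      rw [Finset.union_sdiff_self_eq_union]
      exact Finset.mem_union_right _ (hZ q hq r hr h₁ h₂ x hcol)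
    rw [← himg] at hx
    obtain ⟨s, hs, hsx⟩ := Finset.mem_image.1 hx
    exact ⟨s, Finset.union_subset (solid_mono hmv) hsub hs, by rw [hwg s hs, hsx]⟩) m le_rfl
  have hrange : solid m ℓ v ∪ holes m ℓ = Finset.range v :=
    Finset.sdiff_union_of_subset fun q hq =>
      Finset.mem_range.2 ((lt_of_mem_holes hℓ0 hq).trans_le hmv)
  rw [hrange] at hu
  exact hu.hasGoodSequencing

theorem hasGoodSequencing_of_real_le (S : SteinerTripleSystem X v) {ℓ : ℕ} (hℓ : 3 ≤ ℓ)
    (hv : ((ℓ : ℝ) - 1) * ((ℓ : ℝ) ^ 5 - 9 * (ℓ : ℝ) ^ 3 + 20 * (ℓ : ℝ) ^ 2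
      - 36 * (ℓ : ℝ) + 16) / 16 ≤ (v : ℝ)) : S.HasGoodSequencing ℓ := by
  obtain ⟨n, rfl⟩ : ∃ n, ℓ = n + 3 := ⟨ℓ - 3, by omega⟩
  have hm : 2 * (∑ i ∈ Finset.range (n + 2), i) = (n + 2) * (n + 1) := by
    rw [mul_comm, Finset.sum_range_id_mul_two]
    rfl
  generalize (∑ i ∈ Finset.range (n + 2), i) = m at hm
  refine S.hasGoodSequencing_of_le hℓ (m := m) hm ?_
  rw [show n + 3 - 1 = n + 2 by omega, show n + 3 - 2 = n + 1 by omega]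
  have hm' : (m : ℝ) = (n + 2) * (n + 1) / 2 := by
    have : (2 * m : ℝ) = (n + 2) * (n + 1) := by exact_mod_cast hm
    linarith
  have hn : (0 : ℝ) ≤ n := Nat.cast_nonneg n
  -- The construction needs only order `ℓ ^ 5`; after `ℓ = n + 3` the difference from the stated
  -- bound has nonnegative coefficients.
  have : ((m : ℝ) + m * (n + 2) * (n + 1)) * (n + 3) + (n + 3) ≤ v + 2 := by
    push_cast at hv
    rw [hm']
    refine le_trans ?_ (add_le_add_left hv 2)
    rw [← sub_nonneg]
    ring_nf
    positivity
  exact_mod_cast this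

end SteinerTripleSystem

theorem theorem3p6 :
    (∀ ℓ : ℕ, 3 ≤ ℓ →
      ∀ (v : ℕ) (X : Type u) [Fintype X] (S : SteinerTripleSystem X v),
        ((ℓ : ℝ) - 1) * ((ℓ : ℝ) ^ 5 - 9 * (ℓ : ℝ) ^ 3 + 20 * (ℓ : ℝ) ^ 2
          - 36 * (ℓ : ℝ) + 16) / 16 ≤ (v : ℝ) →
        S.HasGoodSequencing ℓ) ∧
    (∃ n : ℕ → ℕ,
      (∀ ℓ : ℕ, 3 ≤ ℓ →
        ∀ (v : ℕ) (X : Type u) [Fintype X] (S : SteinerTripleSystem X v),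
          n ℓ < v → S.HasGoodSequencing ℓ) ∧
      Asymptotics.IsBigO Filter.atTop (fun ℓ : ℕ => (n ℓ : ℝ)) (fun ℓ : ℕ => (ℓ : ℝ) ^ 6)) := by
  refine ⟨fun ℓ hℓ v X _ S hv => S.hasGoodSequencing_of_real_le hℓ hv, fun ℓ => ℓ ^ 6,
    fun ℓ hℓ v X _ S hv => S.hasGoodSequencing_of_real_le hℓ ?_, ?_⟩
  · have hv' : (ℓ : ℝ) ^ 6 ≤ v := by exact_mod_cast hv.le
    refine le_trans ?_ hv'
    obtain ⟨n, rfl⟩ : ∃ n, ℓ = n + 3 := ⟨ℓ - 3, by omega⟩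
    push_cast
    rw [← sub_nonneg]
    ring_nf
    positivity
  · simpa using Asymptotics.isBigO_refl (fun ℓ : ℕ => (ℓ : ℝ) ^ 6) Filter.atTop
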